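/- Let $\mathbb{T}=\mathbb{R}/\mathbb{Z}$, let $\mathcal{S}(\mathbb{T})$ be the space of infinitely smooth complex-valued functions on $\mathbb{T}$ with its usual Fréchet topology, and let $\mathcal{S}'(\mathbb{T})$ be its topological dual, the space of periodic generalized functions. For $f\in\mathcal{S}'(\mathbb{T})$ and $k\in\mathbb{Z}$ put $\widehat f_k=\langle f,\mathrm{e}^{-2\mathrm{i}\pi k\,\cdot}\rangle$. Fix non-negative Schwartz functions $\varphi_0,\varphi$ on $\mathbb{R}$ with $\operatorname{supp}\varphi_0\subset\{|x|\le 2\}$, $\operatorname{supp}\varphi\subset\{\tfrac12\le|x|\le2\}$ and $\sum_{j\ge0}\varphi_j=1$ on $\mathbb{R}$, where $\varphi_j=\varphi(2^{-j}\,\cdot)$ for $j\ge1$. For $0<p,q\le\infty$ and $s\in\mathbb{R}$, the Besov space $B^s_{p,q}(\mathbb{T})$ is the set of all $f\in\mathcal{S}'(\mathbb{T})$ with $$\Big(\sum_{j\ge0}2^{jsq}\Big\|\sum_{k\in\mathbb{Z}}\varphi_j(k)\widehat f_k\,\mathrm{e}^{2\mathrm{i}\pi k\,\cdot}\Big\|_{L_p(\mathbb{T})}^q\Big)^{1/q}<\infty$$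 (the sum over $j$ being replaced by $\sup_{j\ge0}2^{js}\|\cdot\|_{L_p(\mathbb{T})}$ if $q=\infty$). The number $\sup\{s\in\mathbb{R} : f\in B^s_{p,q}(\mathbb{T})\}\in(-\infty,\infty]$ does not depend on $q\in(0,\infty]$; it is denoted by $s_f(p)$, and $p\mapsto s_f(p)$ is the critical smoothness function of $f$. **Proposition.** Let $f,g\in\mathcal{S}'(\mathbb{T})$ and let $\lambda\in\mathbb{C}$, $\lambda\ne0$. 1. For every $0<p\le\infty$, $s_{\lambda f}(p)=s_f(p)$. 2. If $0<p\le\infty$ is such that $s_f(p)\ne s_g(p)$, then $s_{f+g}(p)=\min(s_f(p),s_g(p))$. 3. If $s_f(p)=s_g(p)$ for at most countably many $p\in(0,\infty]$, then $s_{f+g}(p)=\min(s_f(p),s_g(p))$ for every $0<p\le\infty$. -/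

import Mathlib

open MeasureTheory
open scoped ENNReal ContDiff

noncomputable section

namespace PeriodicBesov

/-! ### Smooth periodic functions and periodic generalized functions -/

/-- The smooth functions on the torus `ℝ / ℤ`: those whose `1`-periodic lift to `ℝ` is smooth. -/
def smoothSubmodule : Submodule ℂ (UnitAddCircle → ℂ) where
  carrier := {u | ContDiff ℝ ∞ (fun x : ℝ => u (x : UnitAddCircle))}
  add_mem' := by
    intro a b ha hb
    rw [Set.mem_ofPred_eq] at ha hb ⊢
    exact ha.add hb
  zero_mem' := by
    rw [Set.mem_ofPred_eq]
    exact contDiff_const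
  smul_mem' := by
    intro c u hu
    rw [Set.mem_ofPred_eq] at hu ⊢
    exact hu.const_smul c

/-- The space `𝒮(𝕋)` of infinitely smooth periodic functions. It is a type of its own, so that it
does not inherit the topology of pointwise convergence. -/
def SmoothPeriodic : Type := smoothSubmodule

instance : AddCommGroup SmoothPeriodic := inferInstanceAs (AddCommGroup smoothSubmodule)

instance : Module ℂ SmoothPeriodic := inferInstanceAs (Module ℂ smoothSubmodule)

/-- The `1`-periodic lift to `ℝ` of an element of `𝒮(𝕋)`. -/
def SmoothPeriodic.lift (u : SmoothPeriodic) : ℝ → ℂ := fun x => u.1 (x : UnitAddCircle)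

theorem SmoothPeriodic.contDiff_lift (u : SmoothPeriodic) : ContDiff ℝ ∞ u.lift := u.2

theorem SmoothPeriodic.lift_add (u v : SmoothPeriodic) : (u + v).lift = u.lift + v.lift := rfl

theorem SmoothPeriodic.lift_smul (c : ℂ) (u : SmoothPeriodic) : (c • u).lift = c • u.lift := rfl

theorem SmoothPeriodic.bddAbove (n : ℕ) (u : SmoothPeriodic) :
    BddAbove (Set.range fun x : Set.Icc (0 : ℝ) 1 => ‖iteratedDeriv n u.lift x‖) := by
  refine (isCompact_range ?_).bddAbove
  have h : Continuous (iteratedDeriv n u.lift) :=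
    u.contDiff_lift.continuous_iteratedDeriv n (by exact_mod_cast le_top)
  fun_prop

/-- The seminorm `u ↦ sup_{x ∈ 𝕋} |u⁽ⁿ⁾(x)|` on `𝒮(𝕋)`. -/
def smoothSeminorm (n : ℕ) : Seminorm ℂ SmoothPeriodic :=
  Seminorm.of (fun u => ⨆ x : Set.Icc (0 : ℝ) 1, ‖iteratedDeriv n u.lift x‖)
    (fun u v => by
      have : Nonempty (Set.Icc (0 : ℝ) 1) := ⟨⟨0, by simp⟩⟩
      refine ciSup_le fun x => ?_
      have hu : ContDiffAt ℝ n u.lift x :=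
        (u.contDiff_lift.of_le (by exact_mod_cast le_top)).contDiffAt
      have hv : ContDiffAt ℝ n v.lift x :=
        (v.contDiff_lift.of_le (by exact_mod_cast le_top)).contDiffAt
      rw [SmoothPeriodic.lift_add, iteratedDeriv_add hu hv]
      exact (norm_add_le _ _).trans
        (add_le_add (le_ciSup (u.bddAbove n) x) (le_ciSup (v.bddAbove n) x)))
    (fun c u => by
      have h : ∀ x : ℝ, iteratedDeriv n (c • u).lift x = c • iteratedDeriv n u.lift x := by
        intro x
        rw [SmoothPeriodic.lift_smul]
        exact iteratedDeriv_const_smul_field c u.lift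
      simp only [h, norm_smul]
      exact (Real.mul_iSup_of_nonneg (norm_nonneg c) _).symm)

/-- The seminorms that define the Fréchet topology of `𝒮(𝕋)`. -/
def smoothSeminormFamily : SeminormFamily ℂ SmoothPeriodic ℕ := smoothSeminorm

/-- The usual Fréchet topology of `𝒮(𝕋)`: uniform convergence of all derivatives. -/
instance : TopologicalSpace SmoothPeriodic := smoothSeminormFamily.moduleFilterBasis.topology

theorem smoothPeriodic_withSeminorms : WithSeminorms smoothSeminormFamily :=
  ⟨rfl⟩

/-- The space `𝒮'(𝕋)` of periodic generalized functions: the topological dual of `𝒮(𝕋)`. -/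
abbrev GenFun : Type := SmoothPeriodic →L[ℂ] ℂ

/-- The exponential `e_k : x ↦ exp (2 π i k x)` as an element of `𝒮(𝕋)`. -/
def expMonomial (k : ℤ) : SmoothPeriodic :=
  ⟨fun x => fourier k x, by
    change ContDiff ℝ ∞ fun x : ℝ => fourier k (x : UnitAddCircle)
    simp only [fourier_coe_apply]
    have h : ContDiff ℝ ∞ (fun x : ℝ => (x : ℂ)) := Complex.ofRealCLM.contDiff
    fun_prop⟩

/-- The Fourier coefficient `f̂_k = ⟨f, e_{-k}⟩` of a periodic generalized function. -/
def fourierCoef (f : GenFun) (k : ℤ) : ℂ := f (expMonomial (-k))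

/-! ### Periodic Besov spaces -/

/-- The `j`-th dyadic piece: `φ₀` for `j = 0` and `φ_j = φ(2⁻ʲ ·)` for `j ≥ 1`. -/
def dyadicPiece (φ₀ φ : ℝ → ℝ) (j : ℕ) (x : ℝ) : ℝ :=
  if j = 0 then φ₀ x else φ (x / 2 ^ j)

/-- A smooth dyadic resolution of unity on `ℝ`: non-negative Schwartz functions `φ₀` and `φ` with
`supp φ₀ ⊆ {|x| ≤ 2}` and `supp φ ⊆ {1/2 ≤ |x| ≤ 2}` such that `φ₀ + ∑_{j ≥ 1} φ(2⁻ʲ ·) = 1`. -/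
structure DyadicSystem where
  /-- the low-frequency function `φ₀` -/
  low : SchwartzMap ℝ ℝ
  /-- the generating function `φ` of the dyadic pieces -/
  gen : SchwartzMap ℝ ℝ
  low_nonneg : ∀ x, 0 ≤ low x
  gen_nonneg : ∀ x, 0 ≤ gen x
  tsupport_low : tsupport low ⊆ {x | |x| ≤ 2}
  tsupport_gen : tsupport gen ⊆ {x | 1 / 2 ≤ |x| ∧ |x| ≤ 2}
  hasSum_one : ∀ x : ℝ, HasSum (fun j : ℕ => dyadicPiece low gen j x) 1

/-- The functions `φ_j`, `j ≥ 0`, of the system. -/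
def DyadicSystem.piece (φ : DyadicSystem) : ℕ → ℝ → ℝ := dyadicPiece φ.low φ.gen

/-- The dyadic block `∑_k φ_j(k) f̂_k e_k` (a trigonometric polynomial, since `φ_j` has compact
support). -/
def block (φ : DyadicSystem) (f : GenFun) (j : ℕ) (x : UnitAddCircle) : ℂ :=
  ∑' k : ℤ, (φ.piece j k : ℂ) * fourierCoef f k * fourier k x

/-- The `L_p` (quasi-)norm over the torus of the `j`-th dyadic block. -/
def blockNorm (φ : DyadicSystem) (p : ℝ≥0∞) (f : GenFun) (j : ℕ) : ℝ≥0∞ :=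
  eLpNorm (block φ f j) p (volume : Measure UnitAddCircle)

/-- The Besov (quasi-)norm, for `0 < p, q ≤ ∞` and `s ∈ ℝ`, with values in `[0, ∞]`. -/
def besovNorm (φ : DyadicSystem) (p q : ℝ≥0∞) (s : ℝ) (f : GenFun) : ℝ≥0∞ :=
  if q = ⊤ then ⨆ j : ℕ, (2 : ℝ≥0∞) ^ ((j : ℝ) * s) * blockNorm φ p f j
  else (∑' j : ℕ, (2 : ℝ≥0∞) ^ ((j : ℝ) * s * q.toReal) * blockNorm φ p f j ^ q.toReal)
    ^ (1 / q.toReal)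

/-- The Besov space `B_{p,q}^s(𝕋)`. -/
def besovSpace (φ : DyadicSystem) (p q : ℝ≥0∞) (s : ℝ) : Set GenFun :=
  {f | besovNorm φ p q s f < ⊤}

/-! ### Critical smoothness -/

/-- The `(p, q)`-critical smoothness `s_f(p, q) = sup {s ∈ ℝ | f ∈ B_{p,q}^s(𝕋)}`, taken in the
extended reals. -/
def criticalSmoothnessPQ (φ : DyadicSystem) (f : GenFun) (p q : ℝ≥0∞) : EReal :=
  sSup ((fun s : ℝ => (s : EReal)) '' {s : ℝ | f ∈ besovSpace φ p q s})

theorem mem_besovSpace_top {φ : DyadicSystem} {f : GenFun} {p q : ℝ≥0∞} (hq : 0 < q) {s : ℝ}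
    (hf : f ∈ besovSpace φ p q s) : f ∈ besovSpace φ p ⊤ s := by
  by_cases hqt : q = ⊤
  · rwa [hqt] at hf
  have hq0 : 0 < q.toReal := ENNReal.toReal_pos hq.ne' hqt
  simp only [besovSpace, Set.mem_ofPred_eq, besovNorm, hqt, if_false, if_true] at hf ⊢
  refine lt_of_le_of_lt (iSup_le fun j => ?_) hf
  rw [one_div, ENNReal.le_rpow_inv_iff hq0]
  refine le_trans (le_of_eq ?_) (ENNReal.le_tsum j)
  rw [ENNReal.mul_rpow_of_nonneg _ _ hq0.le, ← ENNReal.rpow_mul]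

theorem mem_besovSpace_of_lt {φ : DyadicSystem} {f : GenFun} {p q : ℝ≥0∞} (hq : 0 < q) {r s : ℝ}
    (hrs : r < s) (hf : f ∈ besovSpace φ p ⊤ s) : f ∈ besovSpace φ p q r := by
  simp only [besovSpace, Set.mem_ofPred_eq, besovNorm, if_true] at hf ⊢
  set C := ⨆ j : ℕ, (2 : ℝ≥0∞) ^ ((j : ℝ) * s) * blockNorm φ p f j with hC
  have hle : ∀ j : ℕ, (2 : ℝ≥0∞) ^ ((j : ℝ) * r) * blockNorm φ p f j ≤
      (2 : ℝ≥0∞) ^ ((j : ℝ) * (r - s)) * C := by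
    intro j
    have h1 : (2 : ℝ≥0∞) ^ ((j : ℝ) * r) =
        (2 : ℝ≥0∞) ^ ((j : ℝ) * (r - s)) * (2 : ℝ≥0∞) ^ ((j : ℝ) * s) := by
      rw [← ENNReal.rpow_add _ _ (by norm_num) (by norm_num)]
      congr 1
      ring
    rw [h1, mul_assoc]
    gcongr
    exact le_iSup (fun j : ℕ => (2 : ℝ≥0∞) ^ ((j : ℝ) * s) * blockNorm φ p f j) j
  split_ifs with hqt
  · refine lt_of_le_of_lt (iSup_le fun j => (hle j).trans ?_) hf
    refine mul_le_of_le_one_left (zero_le) ?_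
    rw [← ENNReal.rpow_zero (x := 2)]
    exact ENNReal.rpow_le_rpow_of_exponent_le (by norm_num)
      (mul_nonpos_of_nonneg_of_nonpos (Nat.cast_nonneg j) (by linarith))
  · have hq0 : 0 < q.toReal := ENNReal.toReal_pos hq.ne' hqt
    have hC' : C ^ q.toReal < ⊤ := ENNReal.rpow_lt_top_of_nonneg hq0.le hf.ne
    refine ENNReal.rpow_lt_top_of_nonneg (by positivity) (ne_of_lt ?_)
    set ρ : ℝ≥0∞ := (2 : ℝ≥0∞) ^ ((r - s) * q.toReal) with hρ
    have hρ1 : ρ < 1 :=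
      ENNReal.rpow_lt_one_of_one_lt_of_neg (by norm_num) (mul_neg_of_neg_of_pos (by linarith) hq0)
    have hterm : ∀ j : ℕ, (2 : ℝ≥0∞) ^ ((j : ℝ) * r * q.toReal) * blockNorm φ p f j ^ q.toReal ≤
        ρ ^ j * C ^ q.toReal := by
      intro j
      have h2 := ENNReal.rpow_le_rpow (hle j) hq0.le
      rw [ENNReal.mul_rpow_of_nonneg _ _ hq0.le, ENNReal.mul_rpow_of_nonneg _ _ hq0.le,
        ← ENNReal.rpow_mul, ← ENNReal.rpow_mul] at h2
      refine h2.trans (le_of_eq ?_)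
      rw [hρ, ← ENNReal.rpow_natCast, ← ENNReal.rpow_mul]
      congr 2
      ring
    refine lt_of_le_of_lt (ENNReal.tsum_le_tsum hterm) ?_
    rw [ENNReal.tsum_mul_right, ENNReal.tsum_geometric]
    refine ENNReal.mul_lt_top ?_ hC'
    rw [ENNReal.inv_lt_top]
    exact tsub_pos_of_lt hρ1

/-- The `(p, q)`-critical smoothness does not depend on `q`. -/
theorem criticalSmoothnessPQ_eq (φ : DyadicSystem) (f : GenFun) (p : ℝ≥0∞) {q₁ q₂ : ℝ≥0∞}
    (h₁ : 0 < q₁) (h₂ : 0 < q₂) :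
    criticalSmoothnessPQ φ f p q₁ = criticalSmoothnessPQ φ f p q₂ := by
  have key : ∀ {a b : ℝ≥0∞}, 0 < a → 0 < b →
      criticalSmoothnessPQ φ f p a ≤ criticalSmoothnessPQ φ f p b := by
    intro a b ha hb
    refine sSup_le ?_
    rintro _ ⟨s, hs, rfl⟩
    refine EReal.ge_of_forall_gt_iff_ge.1 fun r hr => ?_
    exact le_sSup (Set.mem_image_of_mem _ (mem_besovSpace_of_lt hb (EReal.coe_lt_coe_iff.1 hr)
      (mem_besovSpace_top ha hs)))
  exact le_antisymm (key h₁ h₂) (key h₂ h₁)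

/-- The critical smoothness function `p ↦ s_f(p)`, for `0 < p ≤ ∞`: the common value of the
`s_f(p, q)`, `0 < q ≤ ∞`, obtained here with `q = p`. -/
def criticalSmoothness (φ : DyadicSystem) (f : GenFun) (p : ℝ≥0∞) : EReal :=
  criticalSmoothnessPQ φ f p p

theorem criticalSmoothness_eq (φ : DyadicSystem) (f : GenFun) {p q : ℝ≥0∞} (hp : 0 < p)
    (hq : 0 < q) : criticalSmoothnessPQ φ f p q = criticalSmoothness φ f p :=
  criticalSmoothnessPQ_eq φ f p hq hp

end PeriodicBesov

end

noncomputable section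

namespace PeriodicBesov

/-! ### Trigonometric polynomials and the Nikolskii inequality -/

/-! Everything is read off the growth of the block norms: by independence of `q`, one may take `q =
⊤`, so a bound of the blocks of one function by `C * 2 ^ (j * t)` times those of another becomes an
inequality of critical smoothness with loss `t` (`criticalSmoothness_le_add`). The quasi-triangle
inequality gives `s_{f+g} ≥ min (s_f, s_g)` at once. If `s_f(p) < s_g(p)`, the same bound for `f =
(f + g) - g` forces `s_{f+g}(p) ≤ s_f(p)`, which is the second assertion. For the third, only an
upper bound at coincidence points is missing. Monotonicity of `L_p` norms on a probability space
makes `s_f` nonincreasing, and the Nikolskii inequality for blocks gives `s_f(p) ≤ s_f(q) + 1/p -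
1/q` for `p ≤ q`. So `s_f` is controlled, with a small error, when `q` is approached from below; the
approach can avoid a countable set, and off that set the second assertion applies. -/

instance : IsProbabilityMeasure (volume : Measure UnitAddCircle) := ⟨by simp⟩

/-- The trigonometric polynomials of degree at most `N`. -/
def trigPoly (N : ℕ) : Submodule ℂ C(UnitAddCircle, ℂ) :=
  Submodule.span ℂ ((fun k : ℤ => fourier k) '' (Finset.Icc (-N : ℤ) N : Finset ℤ))

theorem one_mem_trigPoly (N : ℕ) : (1 : C(UnitAddCircle, ℂ)) ∈ trigPoly N := by
  refine Submodule.subset_span ⟨0, by simp, ?_⟩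
  ext x
  simp

theorem mul_mem_trigPoly {M N : ℕ} {P Q : C(UnitAddCircle, ℂ)} (hP : P ∈ trigPoly M)
    (hQ : Q ∈ trigPoly N) : P * Q ∈ trigPoly (M + N) := by
  have h := Submodule.mul_mem_mul hP hQ
  rw [trigPoly, trigPoly, Submodule.span_mul_span] at h
  refine Submodule.span_mono ?_ h
  rintro _ ⟨_, ⟨a, ha, rfl⟩, _, ⟨b, hb, rfl⟩, rfl⟩
  simp only [Finset.coe_Icc, Set.mem_Icc] at ha hb
  refine ⟨a + b, ?_, ?_⟩
  · simp only [Finset.coe_Icc, Set.mem_Icc]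
    push_cast
    omega
  · ext x
    simp

theorem pow_mem_trigPoly {N : ℕ} {P : C(UnitAddCircle, ℂ)} (hP : P ∈ trigPoly N) (m : ℕ) :
    P ^ m ∈ trigPoly (m * N) := by
  induction m with
  | zero => simpa using one_mem_trigPoly 0
  | succ m ih =>
    rw [pow_succ, Nat.succ_mul]
    exact mul_mem_trigPoly ih hP

/-- Parseval's identity for a finite Fourier sum, from orthonormality of the exponentials. -/
theorem lintegral_enorm_sq_sum_fourier (s : Finset ℤ) (c : ℤ → ℂ) :
    ∫⁻ x : UnitAddCircle, ‖(∑ k ∈ s, c k • fourier k : C(UnitAddCircle, ℂ)) x‖ₑ ^ 2 =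
      ENNReal.ofReal (∑ k ∈ s, ‖c k‖ ^ 2) := by
  set P : C(UnitAddCircle, ℂ) := ∑ k ∈ s, c k • fourier k with hP
  have hvol : (volume : Measure UnitAddCircle) = AddCircle.haarAddCircle := by
    rw [AddCircle.volume_eq_smul_haarAddCircle]
    simp
  have hL : ContinuousMap.toLp (E := ℂ) 2 AddCircle.haarAddCircle ℂ P =
      ∑ k ∈ s, c k • fourierLp 2 k := by
    simp [hP, map_sum, map_smul]
  have hn : ‖ContinuousMap.toLp (E := ℂ) 2 AddCircle.haarAddCircle ℂ P‖ ^ 2 =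
      ∑ k ∈ s, ‖c k‖ ^ 2 := by
    rw [hL, @norm_sq_eq_re_inner ℂ, orthonormal_fourier.inner_sum]
    simp [RCLike.conj_mul, ← Complex.ofReal_pow]
  rw [← hn, ENNReal.ofReal_pow (norm_nonneg _), ofReal_norm, Lp.enorm_def,
    eLpNorm_congr_ae (ContinuousMap.coeFn_toLp _ _), hvol,
    eLpNorm_eq_lintegral_rpow_enorm_toReal two_ne_zero ENNReal.ofNat_ne_top,
    ← ENNReal.rpow_natCast, ← ENNReal.rpow_mul]
  simp

/-- Cauchy–Schwarz over the `2 * N + 1` frequencies, combined with Parseval. -/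
theorem enorm_sq_le_of_mem_trigPoly {N : ℕ} {P : C(UnitAddCircle, ℂ)} (hP : P ∈ trigPoly N)
    (x : UnitAddCircle) :
    ‖P x‖ₑ ^ 2 ≤ (2 * N + 1 : ℕ) * ∫⁻ y : UnitAddCircle, ‖P y‖ₑ ^ 2 := by
  obtain ⟨c, rfl⟩ := Submodule.mem_span_image_finset_iff_exists_fun' ℂ |>.1 hP
  rw [lintegral_enorm_sq_sum_fourier, ← ofReal_norm, ← ENNReal.ofReal_pow (norm_nonneg _),
    ← ENNReal.ofReal_natCast, ← ENNReal.ofReal_mul (Nat.cast_nonneg _)]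
  refine ENNReal.ofReal_le_ofReal ?_
  have h1 : ‖(∑ k ∈ Finset.Icc (-N : ℤ) N, c k • fourier k : C(UnitAddCircle, ℂ)) x‖ ≤
      ∑ k ∈ Finset.Icc (-N : ℤ) N, ‖c k‖ := by
    rw [ContinuousMap.sum_apply]
    refine (norm_sum_le _ _).trans (le_of_eq (Finset.sum_congr rfl fun k _ => ?_))
    rw [ContinuousMap.smul_apply, norm_smul, fourier_apply, Circle.norm_coe, mul_one]
  have hcard : (Finset.Icc (-N : ℤ) N).card = 2 * N + 1 := by
    rw [Int.card_Icc]
    omega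
  rw [← hcard]
  exact (pow_le_pow_left₀ (norm_nonneg _) h1 2).trans sq_sum_le_card_mul_sum_sq

/-- The Nikolskii inequality between `L_∞` and `L_p`; the factor depends on an auxiliary
exponent `2 m ≥ p`. -/
theorem enorm_rpow_le_of_mem_trigPoly {N m : ℕ} {P : C(UnitAddCircle, ℂ)} (hP : P ∈ trigPoly N)
    {p : ℝ} (hp : 0 < p) (hpm : p ≤ 2 * m) (x : UnitAddCircle) :
    ‖P x‖ₑ ^ p ≤ (2 * (m * N) + 1 : ℕ) * ∫⁻ y : UnitAddCircle, ‖P y‖ₑ ^ p := by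
  -- The `L_2` bound is applied to `P ^ m`, of degree `m * N`, at a maximum point of `|P|`. There
  -- `|P| ^ (2m)` is at most `|P x₀| ^ (2m - p) * |P| ^ p`, and the first factor cancels from both
  -- sides. This covers `p < 1` as well.
  obtain ⟨x₀, -, hx₀⟩ := isCompact_univ.exists_isMaxOn (Set.univ_nonempty (α := UnitAddCircle))
    (f := fun y => ‖P y‖ₑ) (by fun_prop)
  have hmax : ∀ y, ‖P y‖ₑ ≤ ‖P x₀‖ₑ := fun y => hx₀ (Set.mem_univ y)
  refine (ENNReal.rpow_le_rpow (hmax x) hp.le).trans ?_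
  by_cases h0 : ‖P x₀‖ₑ = 0
  · simp [h0, ENNReal.zero_rpow_of_pos hp]
  have htop : ‖P x₀‖ₑ ≠ ⊤ := enorm_ne_top
  have hsplit : ∀ y, ‖P y‖ₑ ^ (2 * m : ℝ) ≤ ‖P x₀‖ₑ ^ (2 * m - p : ℝ) * ‖P y‖ₑ ^ p := by
    intro y
    calc ‖P y‖ₑ ^ (2 * m : ℝ) = ‖P y‖ₑ ^ (2 * m - p : ℝ) * ‖P y‖ₑ ^ p := by
          rw [← ENNReal.rpow_add_of_nonneg _ _ (by linarith) hp.le, sub_add_cancel]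
      _ ≤ _ := by gcongr; exact hmax y
  have hpow : ∀ y, ‖(P ^ m) y‖ₑ ^ 2 = ‖P y‖ₑ ^ (2 * m : ℝ) := by
    intro y
    rw [ContinuousMap.pow_apply, enorm_pow, ← pow_mul, ← ENNReal.rpow_natCast, mul_comm m]
    push_cast
    rfl
  have h2 := enorm_sq_le_of_mem_trigPoly (pow_mem_trigPoly hP m) x₀
  simp only [hpow] at h2
  have h3 := h2.trans (mul_le_mul_right (lintegral_mono hsplit) _)
  rw [lintegral_const_mul' _ _ (ENNReal.rpow_ne_top_of_nonneg (by linarith) htop)] at h3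
  have h4 : ‖P x₀‖ₑ ^ (2 * m : ℝ) = ‖P x₀‖ₑ ^ (2 * m - p : ℝ) * ‖P x₀‖ₑ ^ p := by
    rw [← ENNReal.rpow_add_of_nonneg _ _ (by linarith) hp.le, sub_add_cancel]
  rw [h4, mul_left_comm] at h3
  exact (ENNReal.mul_le_mul_iff_right (by simp [h0, htop])
    (ENNReal.rpow_ne_top_of_nonneg (by linarith) htop)).1 h3

/-- For finite `q`, interpolate: write `|P| ^ q = |P| ^ (q - p) * |P| ^ p` and bound the first
factor by the sup estimate. -/
theorem eLpNorm_le_of_mem_trigPoly {N m : ℕ} {P : C(UnitAddCircle, ℂ)} (hP : P ∈ trigPoly N)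
    {p q : ℝ≥0∞} (hp : 0 < p) (hpt : p ≠ ⊤) (hpq : p ≤ q) (hpm : p.toReal ≤ 2 * m) :
    eLpNorm P q volume ≤
      ((2 * (m * N) + 1 : ℕ) : ℝ≥0∞) ^ (p.toReal⁻¹ - q.toReal⁻¹) * eLpNorm P p volume := by
  have hp0 : 0 < p.toReal := ENNReal.toReal_pos hp.ne' hpt
  set K : ℝ≥0∞ := ((2 * (m * N) + 1 : ℕ) : ℝ≥0∞) with hK
  have hKt : K ≠ ⊤ := ENNReal.natCast_ne_top _
  have hsup : ∀ x, ‖P x‖ₑ ≤ K ^ p.toReal⁻¹ * eLpNorm P p volume := by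
    intro x
    rw [eLpNorm_eq_lintegral_rpow_enorm_toReal hp.ne' hpt, one_div,
      ← ENNReal.mul_rpow_of_nonneg _ _ (inv_nonneg.2 hp0.le), ENNReal.le_rpow_inv_iff hp0]
    exact enorm_rpow_le_of_mem_trigPoly hP hp0 hpm x
  by_cases hqt : q = ⊤
  · subst hqt
    -- The conventions `⊤.toReal = 0` and `0⁻¹ = 0` give `1/q = 0` here, as they should.
    rw [eLpNorm_exponent_top, ENNReal.toReal_top, inv_zero, sub_zero]
    exact essSup_le_of_ae_le _ (Filter.Eventually.of_forall hsup)
  have hpq' : p.toReal ≤ q.toReal := ENNReal.toReal_mono hqt hpq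
  have hq0 : 0 < q.toReal := hp0.trans_le hpq'
  set L := eLpNorm P p volume with hL
  have hLt : L ≠ ⊤ := (P.continuous.memLp_of_hasCompactSupport
    (HasCompactSupport.of_compactSpace _)).eLpNorm_ne_top
  have hLp : ∫⁻ y : UnitAddCircle, ‖P y‖ₑ ^ p.toReal = L ^ p.toReal := by
    rw [hL, eLpNorm_eq_lintegral_rpow_enorm_toReal hp.ne' hpt, one_div, ENNReal.rpow_inv_rpow hp0.ne']
  have hA : (K ^ p.toReal⁻¹ * L) ^ (q.toReal - p.toReal) ≠ ⊤ :=
    ENNReal.rpow_ne_top_of_nonneg (by linarith)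
      (ENNReal.mul_ne_top (ENNReal.rpow_ne_top_of_nonneg (by positivity) hKt) hLt)
  rw [eLpNorm_eq_lintegral_rpow_enorm_toReal (hp.trans_le hpq).ne' hqt, one_div,
    ENNReal.rpow_inv_le_iff hq0]
  calc ∫⁻ y : UnitAddCircle, ‖P y‖ₑ ^ q.toReal
      ≤ ∫⁻ y : UnitAddCircle, (K ^ p.toReal⁻¹ * L) ^ (q.toReal - p.toReal) *
          ‖P y‖ₑ ^ p.toReal := by
        refine lintegral_mono fun y => ?_
        calc ‖P y‖ₑ ^ q.toReal = ‖P y‖ₑ ^ (q.toReal - p.toReal) * ‖P y‖ₑ ^ p.toReal := by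
              rw [← ENNReal.rpow_add_of_nonneg _ _ (by linarith) hp0.le, sub_add_cancel]
          _ ≤ _ := by gcongr; exact hsup y
    _ = (K ^ p.toReal⁻¹ * L) ^ (q.toReal - p.toReal) * L ^ p.toReal := by
        rw [lintegral_const_mul' _ _ hA, hLp]
    _ = (K ^ (p.toReal⁻¹ - q.toReal⁻¹) * L) ^ q.toReal := by
        rw [ENNReal.mul_rpow_of_nonneg _ _ (by linarith), ENNReal.mul_rpow_of_nonneg _ _ hq0.le,
          mul_assoc, ← ENNReal.rpow_add_of_nonneg _ _ (by linarith) hp0.le, sub_add_cancel,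
          ← ENNReal.rpow_mul, ← ENNReal.rpow_mul]
        congr 2
        field_simp

/-! ### Dyadic blocks -/

theorem DyadicSystem.piece_eq_zero (φ : DyadicSystem) {j : ℕ} {x : ℝ} (hx : 2 ^ (j + 1) < |x|) :
    φ.piece j x = 0 := by
  unfold DyadicSystem.piece dyadicPiece
  split_ifs with hj
  · subst hj
    refine image_eq_zero_of_notMem_tsupport fun h => ?_
    have := φ.tsupport_low h
    simp only [Set.mem_ofPred_eq] at this
    norm_num at hx
    linarith
  · refine image_eq_zero_of_notMem_tsupport fun h => ?_
    have h2 := (φ.tsupport_gen h).2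
    rw [abs_div, abs_of_pos (by positivity : (0 : ℝ) < 2 ^ j), div_le_iff₀ (by positivity)] at h2
    rw [pow_succ] at hx
    linarith

/-- The dyadic block as a continuous function. -/
def blockMap (φ : DyadicSystem) (f : GenFun) (j : ℕ) : C(UnitAddCircle, ℂ) :=
  ∑ k ∈ Finset.Icc (-(2 ^ (j + 1) : ℕ) : ℤ) (2 ^ (j + 1) : ℕ),
    ((φ.piece j k : ℂ) * fourierCoef f k) • fourier k

theorem coe_blockMap (φ : DyadicSystem) (f : GenFun) (j : ℕ) : ⇑(blockMap φ f j) = block φ f j := by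
  ext x
  rw [block, tsum_eq_sum (s := Finset.Icc (-(2 ^ (j + 1) : ℕ) : ℤ) (2 ^ (j + 1) : ℕ))]
  · simp [blockMap, ContinuousMap.sum_apply]
  · intro k hk
    have hk' : ((2 ^ (j + 1) : ℕ) : ℤ) < |k| := by
      rw [Finset.mem_Icc, ← abs_le, not_le] at hk
      exact hk
    rw [φ.piece_eq_zero]
    · simp
    · exact_mod_cast hk'

theorem blockMap_mem_trigPoly (φ : DyadicSystem) (f : GenFun) (j : ℕ) :
    blockMap φ f j ∈ trigPoly (2 ^ (j + 1)) :=
  Submodule.sum_mem _ fun k hk => Submodule.smul_mem _ _ (Submodule.subset_span ⟨k, hk, rfl⟩)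

theorem blockMap_add (φ : DyadicSystem) (f g : GenFun) (j : ℕ) :
    blockMap φ (f + g) j = blockMap φ f j + blockMap φ g j := by
  rw [blockMap, blockMap, blockMap, ← Finset.sum_add_distrib]
  refine Finset.sum_congr rfl fun k _ => ?_
  ext x
  change (φ.piece j k : ℂ) * (fourierCoef f k + fourierCoef g k) * fourier k x =
    φ.piece j k * fourierCoef f k * fourier k x + φ.piece j k * fourierCoef g k * fourier k x
  ring

theorem blockMap_smul (φ : DyadicSystem) (c : ℂ) (f : GenFun) (j : ℕ) :
    blockMap φ (c • f) j = c • blockMap φ f j := by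
  simp [blockMap, fourierCoef, Finset.smul_sum, smul_smul, mul_left_comm]

theorem blockNorm_eq (φ : DyadicSystem) (p : ℝ≥0∞) (f : GenFun) (j : ℕ) :
    blockNorm φ p f j = eLpNorm (blockMap φ f j) p volume := by
  rw [blockNorm, coe_blockMap]

theorem blockNorm_smul (φ : DyadicSystem) (p : ℝ≥0∞) (c : ℂ) (f : GenFun) (j : ℕ) :
    blockNorm φ p (c • f) j = ‖c‖ₑ * blockNorm φ p f j := by
  rw [blockNorm_eq, blockNorm_eq, blockMap_smul, ContinuousMap.coe_smul, eLpNorm_const_smul]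

theorem blockNorm_add_le (φ : DyadicSystem) (p : ℝ≥0∞) (f g : GenFun) (j : ℕ) :
    blockNorm φ p (f + g) j ≤ ENNReal.LpAddConst p * (blockNorm φ p f j + blockNorm φ p g j) := by
  simp only [blockNorm_eq, blockMap_add, ContinuousMap.coe_add]
  exact eLpNorm_add_le' (ContinuousMap.continuous _).aestronglyMeasurable
    (ContinuousMap.continuous _).aestronglyMeasurable p

theorem blockNorm_mono (φ : DyadicSystem) {p q : ℝ≥0∞} (hpq : p ≤ q) (f : GenFun) (j : ℕ) :
    blockNorm φ p f j ≤ blockNorm φ q f j := by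
  simp only [blockNorm_eq]
  exact eLpNorm_le_eLpNorm_of_exponent_le hpq (ContinuousMap.continuous _).aestronglyMeasurable

theorem exists_blockNorm_le (φ : DyadicSystem) {p q : ℝ≥0∞} (hp : 0 < p) (hpt : p ≠ ⊤)
    (hpq : p ≤ q) (f : GenFun) : ∃ C : ℝ≥0∞, C ≠ ⊤ ∧ ∀ j : ℕ, blockNorm φ q f j ≤
      C * (2 : ℝ≥0∞) ^ ((j : ℝ) * (p.toReal⁻¹ - q.toReal⁻¹)) * blockNorm φ p f j := by
  obtain ⟨m, hm⟩ := exists_nat_ge p.toReal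
  have hp0 : 0 < p.toReal := ENNReal.toReal_pos hp.ne' hpt
  set t := p.toReal⁻¹ - q.toReal⁻¹ with ht
  have ht0 : 0 ≤ t := by
    by_cases hqt : q = ⊤
    · simp [ht, hqt]
    · exact sub_nonneg.2 (inv_anti₀ hp0 (ENNReal.toReal_mono hqt hpq))
  -- The block has degree `2 ^ (j + 1)`, and `2 * m * 2 ^ (j + 1) + 1 ≤ (4 * m + 1) * 2 ^ j`.
  refine ⟨((4 * m + 1 : ℕ) : ℝ≥0∞) ^ t,
    ENNReal.rpow_ne_top_of_nonneg ht0 (ENNReal.natCast_ne_top _), fun j => ?_⟩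
  simp only [blockNorm_eq]
  refine (eLpNorm_le_of_mem_trigPoly (m := m) (blockMap_mem_trigPoly φ f j) hp hpt hpq
    (by linarith [(Nat.cast_nonneg m : (0 : ℝ) ≤ m)])).trans ?_
  rw [ENNReal.rpow_mul, ENNReal.rpow_natCast, ← ENNReal.mul_rpow_of_nonneg _ _ ht0]
  gcongr
  norm_cast
  have : 1 ≤ 2 ^ j := Nat.one_le_two_pow
  rw [pow_succ]
  nlinarith

/-! ### Comparison of critical smoothness -/

theorem mem_besovSpace_top_iff {φ : DyadicSystem} {f : GenFun} {p : ℝ≥0∞} {s : ℝ} :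
    f ∈ besovSpace φ p ⊤ s ↔
      ⨆ j : ℕ, (2 : ℝ≥0∞) ^ ((j : ℝ) * s) * blockNorm φ p f j < ⊤ := by
  simp [besovSpace, besovNorm]

theorem le_criticalSmoothness {φ : DyadicSystem} {f : GenFun} {p : ℝ≥0∞} (hp : 0 < p) {s : ℝ}
    (hf : f ∈ besovSpace φ p ⊤ s) : (s : EReal) ≤ criticalSmoothness φ f p := by
  rw [← criticalSmoothness_eq φ f hp ENNReal.zero_lt_top]
  exact le_sSup (Set.mem_image_of_mem _ hf)

theorem mem_besovSpace_of_lt_criticalSmoothness {φ : DyadicSystem} {f : GenFun} {p : ℝ≥0∞}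
    (hp : 0 < p) {s : ℝ} (hs : (s : EReal) < criticalSmoothness φ f p) :
    f ∈ besovSpace φ p ⊤ s := by
  rw [← criticalSmoothness_eq φ f hp ENNReal.zero_lt_top, criticalSmoothnessPQ, lt_sSup_iff] at hs
  obtain ⟨_, ⟨r, hr, rfl⟩, hsr⟩ := hs
  exact mem_besovSpace_of_lt ENNReal.zero_lt_top (EReal.coe_lt_coe_iff.1 hsr) hr

theorem criticalSmoothness_le_add {φ : DyadicSystem} {f g : GenFun} {p q : ℝ≥0∞} (hp : 0 < p)
    (hq : 0 < q) {C : ℝ≥0∞} (hC : C ≠ ⊤) (t : ℝ)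
    (h : ∀ j : ℕ, blockNorm φ q g j ≤ C * (2 : ℝ≥0∞) ^ ((j : ℝ) * t) * blockNorm φ p f j) :
    criticalSmoothness φ f p ≤ criticalSmoothness φ g q + t := by
  refine EReal.ge_of_forall_gt_iff_ge.1 fun s hs => ?_
  have hf := mem_besovSpace_top_iff.1 (mem_besovSpace_of_lt_criticalSmoothness hp hs)
  have hg : g ∈ besovSpace φ q ⊤ (s - t) := by
    refine mem_besovSpace_top_iff.2 (lt_of_le_of_lt (iSup_le fun j => ?_)
      (ENNReal.mul_lt_top hC.lt_top hf))
    have h2 : (2 : ℝ≥0∞) ^ ((j : ℝ) * s) =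
        (2 : ℝ≥0∞) ^ ((j : ℝ) * (s - t)) * (2 : ℝ≥0∞) ^ ((j : ℝ) * t) := by
      rw [← ENNReal.rpow_add _ _ (by norm_num) (by norm_num)]
      congr 1
      ring
    calc (2 : ℝ≥0∞) ^ ((j : ℝ) * (s - t)) * blockNorm φ q g j
        ≤ (2 : ℝ≥0∞) ^ ((j : ℝ) * (s - t)) *
            (C * (2 : ℝ≥0∞) ^ ((j : ℝ) * t) * blockNorm φ p f j) := by gcongr; exact h j
      _ = C * ((2 : ℝ≥0∞) ^ ((j : ℝ) * s) * blockNorm φ p f j) := by rw [h2]; ring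
      _ ≤ _ := by
        gcongr
        exact le_iSup (fun j : ℕ => (2 : ℝ≥0∞) ^ ((j : ℝ) * s) * blockNorm φ p f j) j
  calc (s : EReal) = ((s - t : ℝ) : EReal) + t := by
        rw [← EReal.coe_add, sub_add_cancel]
    _ ≤ _ := by gcongr; exact le_criticalSmoothness hq hg

theorem criticalSmoothness_antitone (φ : DyadicSystem) (f : GenFun) {p q : ℝ≥0∞} (hp : 0 < p)
    (hpq : p ≤ q) : criticalSmoothness φ f q ≤ criticalSmoothness φ f p := by
  simpa using criticalSmoothness_le_add (hp.trans_le hpq) hp ENNReal.one_ne_top 0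
    (fun j => by simpa using blockNorm_mono φ hpq f j)

/-- The Sobolev-type embedding in dimension one, as a consequence of Nikolskii on each block. -/
theorem criticalSmoothness_le_add_inv_sub_inv (φ : DyadicSystem) (f : GenFun) {p q : ℝ≥0∞}
    (hp : 0 < p) (hpt : p ≠ ⊤) (hpq : p ≤ q) :
    criticalSmoothness φ f p ≤
      criticalSmoothness φ f q + ((p.toReal⁻¹ - q.toReal⁻¹ : ℝ) : EReal) := by
  obtain ⟨C, hC, h⟩ := exists_blockNorm_le φ hp hpt hpq f
  exact criticalSmoothness_le_add hp (hp.trans_le hpq) hC _ h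

theorem criticalSmoothness_smul (φ : DyadicSystem) (f : GenFun) {c : ℂ} (hc : c ≠ 0) {p : ℝ≥0∞}
    (hp : 0 < p) : criticalSmoothness φ (c • f) p = criticalSmoothness φ f p := by
  -- Multiplication by any scalar cannot lower smoothness; equality follows by undoing it with
  -- `c⁻¹`.
  have key : ∀ (f : GenFun) (c : ℂ),
      criticalSmoothness φ f p ≤ criticalSmoothness φ (c • f) p := by
    intro f c
    simpa using criticalSmoothness_le_add (g := c • f) hp hp (enorm_ne_top (x := c)) 0
      (fun j => by simp [blockNorm_smul])
  refine le_antisymm ?_ (key f c)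
  simpa [smul_smul, hc] using key (c • f) c⁻¹

/-! ### Critical smoothness of a sum -/

theorem min_le_criticalSmoothness_add (φ : DyadicSystem) (f g : GenFun) {p : ℝ≥0∞} (hp : 0 < p) :
    min (criticalSmoothness φ f p) (criticalSmoothness φ g p) ≤
      criticalSmoothness φ (f + g) p := by
  refine EReal.ge_of_forall_gt_iff_ge.1 fun s hs => ?_
  rw [lt_min_iff] at hs
  have hf := mem_besovSpace_top_iff.1 (mem_besovSpace_of_lt_criticalSmoothness hp hs.1)
  have hg := mem_besovSpace_top_iff.1 (mem_besovSpace_of_lt_criticalSmoothness hp hs.2)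
  refine le_criticalSmoothness hp (mem_besovSpace_top_iff.2 (lt_of_le_of_lt (iSup_le fun j => ?_)
    (ENNReal.mul_lt_top (ENNReal.LpAddConst_lt_top p) (ENNReal.add_lt_top.2 ⟨hf, hg⟩))))
  calc (2 : ℝ≥0∞) ^ ((j : ℝ) * s) * blockNorm φ p (f + g) j
      ≤ (2 : ℝ≥0∞) ^ ((j : ℝ) * s) *
          (ENNReal.LpAddConst p * (blockNorm φ p f j + blockNorm φ p g j)) := by
        gcongr; exact blockNorm_add_le φ p f g j
    _ = ENNReal.LpAddConst p * ((2 : ℝ≥0∞) ^ ((j : ℝ) * s) * blockNorm φ p f j +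
          (2 : ℝ≥0∞) ^ ((j : ℝ) * s) * blockNorm φ p g j) := by ring
    _ ≤ _ := by
        gcongr
        · exact le_iSup (fun j : ℕ => (2 : ℝ≥0∞) ^ ((j : ℝ) * s) * blockNorm φ p f j) j
        · exact le_iSup (fun j : ℕ => (2 : ℝ≥0∞) ^ ((j : ℝ) * s) * blockNorm φ p g j) j

/-- Since `f = (f + g) - g`, `s_f` is at least the minimum of `s_{f+g}` and `s_g`; by hypothesis
`s_g` cannot realise it. -/
theorem criticalSmoothness_add_le_of_lt (φ : DyadicSystem) {f g : GenFun} {p : ℝ≥0∞} (hp : 0 < p)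
    (h : criticalSmoothness φ f p < criticalSmoothness φ g p) :
    criticalSmoothness φ (f + g) p ≤ criticalSmoothness φ f p := by
  have h1 := min_le_criticalSmoothness_add φ (f + g) ((-1 : ℂ) • g) hp
  have h2 : g + (-1 : ℂ) • g = 0 := ContinuousLinearMap.ext fun u => by
    change g u + -1 * g u = 0
    ring
  rw [criticalSmoothness_smul φ g (by simp) hp, add_assoc, h2, add_zero] at h1
  exact (min_le_iff.1 h1).resolve_right h.not_ge

theorem criticalSmoothness_add_of_ne (φ : DyadicSystem) {f g : GenFun} {p : ℝ≥0∞} (hp : 0 < p)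
    (h : criticalSmoothness φ f p ≠ criticalSmoothness φ g p) :
    criticalSmoothness φ (f + g) p =
      min (criticalSmoothness φ f p) (criticalSmoothness φ g p) := by
  refine le_antisymm ?_ (min_le_criticalSmoothness_add φ f g hp)
  rcases h.lt_or_gt with h | h
  · rw [min_eq_left h.le]
    exact criticalSmoothness_add_le_of_lt φ hp h
  · rw [min_eq_right h.le, add_comm f g]
    exact criticalSmoothness_add_le_of_lt φ hp h

/-- A countable set of exponents can be avoided while approaching any exponent from below. -/
theorem exists_notMem_inv_lt_add {E : Set ℝ≥0∞} (hE : E.Countable) {q : ℝ≥0∞} (hq : 0 < q) {ε : ℝ}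
    (hε : 0 < ε) : ∃ p : ℝ≥0∞, 0 < p ∧ p ≠ ⊤ ∧ p ≤ q ∧ p ∉ E ∧
      p.toReal⁻¹ < q.toReal⁻¹ + ε := by
  set u : ℝ → ℝ≥0∞ := fun t => (ENNReal.ofReal t)⁻¹ with hu
  -- In the variable `t = 1/p` the excluded exponents form a countable set of reals, whose
  -- complement is dense and so meets `(1/q, 1/q + ε)`.
  have hcount : {t : ℝ | 0 < t ∧ u t ∈ E}.Countable := by
    refine Set.MapsTo.countable_of_injOn (f := u) (t := E) (fun t ht => ht.2) ?_ hE
    intro a ha b hb hab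
    exact (ENNReal.ofReal_eq_ofReal_iff ha.1.le hb.1.le).1 (inv_injective hab)
  obtain ⟨t, ht, ht2⟩ := (hcount.dense_compl ℝ).exists_between
    (lt_add_of_pos_right q.toReal⁻¹ hε)
  have ht0 : 0 < t := (inv_nonneg.2 ENNReal.toReal_nonneg).trans_lt ht2.1
  refine ⟨u t, by simp [hu], by simp [hu, ht0], ?_, fun h => ht ⟨ht0, h⟩, ?_⟩
  · rw [hu, ENNReal.inv_le_iff_inv_le]
    by_cases hqt : q = ⊤
    · simp [hqt]
    · rw [ENNReal.le_ofReal_iff_toReal_le (by simp [hq.ne']) ht0.le, ENNReal.toReal_inv]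
      exact ht2.1.le
  · simpa [hu, ENNReal.toReal_inv, ENNReal.toReal_ofReal ht0.le] using ht2.2

theorem criticalSmoothness_add_of_countable (φ : DyadicSystem) {f g : GenFun}
    (h : {p : ℝ≥0∞ | 0 < p ∧
      criticalSmoothness φ f p = criticalSmoothness φ g p}.Countable) {q : ℝ≥0∞} (hq : 0 < q) :
    criticalSmoothness φ (f + g) q =
      min (criticalSmoothness φ f q) (criticalSmoothness φ g q) := by
  refine le_antisymm ?_ (min_le_criticalSmoothness_add φ f g hq)
  have key : ∀ ε : ℝ, 0 < ε → criticalSmoothness φ (f + g) q ≤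
      min (criticalSmoothness φ f q + ε) (criticalSmoothness φ g q + ε) := by
    intro ε hε
    obtain ⟨p, hp, hpt, hpq, hpE, hpε⟩ := exists_notMem_inv_lt_add h hq hε
    have hne : criticalSmoothness φ f p ≠ criticalSmoothness φ g p := fun e => hpE ⟨hp, e⟩
    have hcont : ∀ u : GenFun, criticalSmoothness φ u p ≤ criticalSmoothness φ u q + ε := by
      intro u
      refine (criticalSmoothness_le_add_inv_sub_inv φ u hp hpt hpq).trans ?_
      gcongr
      linarith
    -- Moving from `q` down to `p` costs nothing for `f + g`; returning from `p` to `q` costs at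
    -- most `ε` for each of `f` and `g`.
    refine (criticalSmoothness_antitone φ (f + g) hp hpq).trans ?_
    rw [criticalSmoothness_add_of_ne φ hp hne]
    exact min_le_min (hcont f) (hcont g)
  have lim : ∀ a b : EReal, (∀ ε : ℝ, 0 < ε → a ≤ b + ε) → a ≤ b := by
    intro a b hab
    refine EReal.le_of_forall_lt_iff_le.1 fun z hz => ?_
    -- Infinite values are possible in `EReal`; for `b = ⊥` the hypothesis with `ε = 1` already
    -- gives `a ≤ ⊥`.
    induction b with
    | bot => exact (hab 1 one_pos).trans (by simp)
    | top => simp at hz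
    | coe b =>
      have hbz : b < z := EReal.coe_lt_coe_iff.1 hz
      refine (hab (z - b) (sub_pos.2 hbz)).trans (le_of_eq ?_)
      rw [← EReal.coe_add, add_sub_cancel]
  exact le_min (lim _ _ fun ε hε => (key ε hε).trans (min_le_left _ _))
    (lim _ _ fun ε hε => (key ε hε).trans (min_le_right _ _))

end PeriodicBesov

end

theorem mainTheorem5 (φ : PeriodicBesov.DyadicSystem) :
    (∀ (f : PeriodicBesov.GenFun) (c : ℂ), c ≠ 0 → ∀ p : ENNReal, 0 < p →
      PeriodicBesov.criticalSmoothness φ (c • f) p = PeriodicBesov.criticalSmoothness φ f p) ∧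
    (∀ (f g : PeriodicBesov.GenFun) (p : ENNReal), 0 < p →
      PeriodicBesov.criticalSmoothness φ f p ≠ PeriodicBesov.criticalSmoothness φ g p →
      PeriodicBesov.criticalSmoothness φ (f + g) p =
        min (PeriodicBesov.criticalSmoothness φ f p) (PeriodicBesov.criticalSmoothness φ g p)) ∧
    (∀ f g : PeriodicBesov.GenFun,
      {p : ENNReal | 0 < p ∧ PeriodicBesov.criticalSmoothness φ f p =
        PeriodicBesov.criticalSmoothness φ g p}.Countable →
      ∀ p : ENNReal, 0 < p → PeriodicBesov.criticalSmoothness φ (f + g) p =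
        min (PeriodicBesov.criticalSmoothness φ f p)
          (PeriodicBesov.criticalSmoothness φ g p)) := by
  exact ⟨fun f c hc p hp => PeriodicBesov.criticalSmoothness_smul φ f hc hp,
    fun f g p hp h => PeriodicBesov.criticalSmoothness_add_of_ne φ hp h,
    fun f g h p hp => PeriodicBesov.criticalSmoothness_add_of_countable φ h hp⟩
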